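/- Let $\mathcal L$ be a countable first-order language, let $T$ be a complete $\mathcal L$-theory that is stable, i.e. for some infinite cardinal $\kappa$ one has $|S_n^{\mathbf N}(A)|\leqslant\kappa$ for every model $\mathbf N\models T$, every subset $A\subseteq\mathbf N$ with $|A|\leqslant\kappa$ and every $n$, where $S_n^{\mathbf N}(A)$ is the space of complete $n$-types over $A$. Let $\mathbf M$ be a countable atomic model of $T$ (every type over $\emptyset$ realised in $\mathbf M$ by a finite tuple is isolated), and equip $\mathrm{Aut}(\mathbf M)$ with the permutation group topology, generated by the left cosets of the pointwise stabilisers of finite subsets of $\mathbf M$. A metric on $G=\mathrm{Aut}(\mathbf M)$ is *compatible* if it induces the topology of $G$. A compatible left-invariant metric $d$ on $G$ is *maximal* if it is maximal among the compatible left-invariant metrics with respect to the ordering in which $\partial\lesssim d$ if and only if $\partial\leqslant K\cdot d+K$ for some constant $K$. A set $A\subseteq G$ has *property (OB) relative to $G$* if it has finite diameter with respect to every compatible left-invariant metric on $G$, and a compatible left-invariant metric $d$ is *metrically proper* if the $d$-bounded sets are exactly the sets having property (OB) relative to $G$. A metric $d$ on a set $X$ is *stable* if, for all $d$-bounded sequences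 $(x_n)$ and $(y_m)$ in $X$, $$\lim_{n\to\infty}\lim_{m\to\infty}d(x_n,y_m)=\lim_{m\to\infty}\lim_{n\to\infty}d(x_n,y_m)$$ whenever both iterated limits exist. Then: 1. If $\mathrm{Aut}(\mathbf M)$ admits a maximal compatible left-invariant metric, then it admits a maximal compatible left-invariant metric that is, moreover, stable. 2. If $\mathrm{Aut}(\mathbf M)$ admits a metrically proper compatible left-invariant metric, then it admits a metrically proper compatible left-invariant metric that is, moreover, stable. -/

import Mathlib

open FirstOrder Filter Topology

universe u v w

namespace AutGeometry

/-! ## Large scale geometry of a topological group -/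

section Group

variable {G : Type w} [Group G] [t : TopologicalSpace G]

/-- `d` is a left-invariant metric on `G` inducing the given topology of `G`. -/
structure IsCompatibleLeftInvariant (d : MetricSpace G) : Prop where
  compatible : d.toUniformSpace.toTopologicalSpace = t
  left_invariant : ∀ g x y : G, d.dist (g * x) (g * y) = d.dist x y

/-- `A` has finite diameter with respect to `d`. -/
def IsBoundedFor {X : Type w} (d : MetricSpace X) (A : Set X) : Prop :=
  ∃ C : ℝ, ∀ x ∈ A, ∀ y ∈ A, d.dist x y ≤ C

/-- `A` has property (OB) relative to `G`: it has finite diameter with respect to every compatible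
left-invariant metric on `G`. -/
def HasRelativeOB (A : Set G) : Prop :=
  ∀ d : MetricSpace G, IsCompatibleLeftInvariant d → IsBoundedFor d A

/-- A metric on `G` is metrically proper if its bounded sets are exactly the sets having
property (OB) relative to `G`. -/
def IsMetricallyProper (d : MetricSpace G) : Prop :=
  ∀ A : Set G, IsBoundedFor d A ↔ HasRelativeOB A

/-- The ordering `∂ ≲ d` of metrics: `∂ ≤ K * d + K` for some constant `K`. -/
def CoarselyLE {X : Type w} (e d : MetricSpace X) : Prop :=
  ∃ K : ℝ, ∀ x y : X, e.dist x y ≤ K * d.dist x y + K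

/-- A metric on `G` is maximal if it is a maximal element of the compatible left-invariant metrics
with respect to the ordering `CoarselyLE`. -/
def IsMaximalMetric (d : MetricSpace G) : Prop :=
  IsCompatibleLeftInvariant d ∧
    ∀ e : MetricSpace G, IsCompatibleLeftInvariant e → CoarselyLE d e → CoarselyLE e d

end Group

/-- A metric is stable (in the sense of Krivine and Maurey) if, for all bounded sequences `x`, `y`,
the two iterated limits of `d (x n) (y m)` agree whenever both of them exist. -/
def IsStableMetric {X : Type w} (d : MetricSpace X) : Prop :=
  ∀ x y : ℕ → X, IsBoundedFor d (Set.range x) → IsBoundedFor d (Set.range y) →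
    ∀ (a b : ℕ → ℝ) (r s : ℝ),
      (∀ n, Tendsto (fun m => d.dist (x n) (y m)) atTop (𝓝 (a n))) → Tendsto a atTop (𝓝 r) →
      (∀ m, Tendsto (fun n => d.dist (x n) (y m)) atTop (𝓝 (b m))) → Tendsto b atTop (𝓝 s) →
      r = s

/-! ## The automorphism group of a structure -/

section Aut

variable (L : FirstOrder.Language.{u, v}) (M : Type w) [L.Structure M]

/-- The automorphisms of an `L`-structure `M`. -/
abbrev Aut : Type w := M ≃[L] M

instance instGroupAut : Group (Aut L M) where
  mul g f := g.comp f
  one := FirstOrder.Language.Equiv.refl L M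
  inv g := g.symm
  mul_assoc _ _ _ := rfl
  one_mul _ := rfl
  mul_one _ := rfl
  inv_mul_cancel g := g.symm_comp_self

/-- The permutation group topology: it is generated by the left cosets `f V_A` of the pointwise
stabilisers `V_A` of the finite subsets `A` of `M`. -/
instance instTopologicalSpaceAut : TopologicalSpace (Aut L M) :=
  TopologicalSpace.generateFrom
    {U | ∃ (f : Aut L M) (A : Finset M), U = {g : Aut L M | ∀ x ∈ A, g x = f x}}

end Aut

/-! ## Stable theories and atomic models -/

section Theories

variable {L : FirstOrder.Language.{u, v}}

/-- The space `S_n^N(A)` of complete `n`-types over the subset `A` of the structure `N`. -/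
abbrev TypesOver (N : Type w) [L.Structure N] (A : Set N) (n : ℕ) :=
  (L[[A]].completeTheory N).CompleteType (Fin n)

/-- `T` is `κ`-stable if, for every model `N` of `T` and every subset `A` of `N` with at most `κ`
elements, there are, for every `n`, at most `κ` complete `n`-types over `A`. -/
def IsStableIn (T : L.Theory) (κ : Cardinal.{max u v w}) : Prop :=
  ∀ (N : Type (max u v w)) [L.Structure N] [Nonempty N] [N ⊨ T] (A : Set N),
    Cardinal.mk A ≤ κ → ∀ n : ℕ, Cardinal.mk (TypesOver (L := L) N A n) ≤ κ

/-- `T` is stable if it is `κ`-stable for some infinite cardinal `κ`. -/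
def IsStableTheory (T : L.Theory) : Prop :=
  ∃ κ : Cardinal.{max u v w}, Cardinal.aleph0 ≤ κ ∧ IsStableIn.{u, v, w} T κ

/-- `M` is an atomic model of `T`: the type of every finite tuple of `M` is isolated by one of the
formulas it contains. -/
def IsAtomicModel (T : L.Theory) (M : Type w) [L.Structure M] : Prop :=
  M ⊨ T ∧ ∀ (n : ℕ) (a : Fin n → M), ∃ φ : L.Formula (Fin n), φ.Realize a ∧
    ∀ ψ : L.Formula (Fin n), ψ.Realize a → T ⊨ᵇ φ.imp ψ

end Theories

end AutGeometry

open AutGeometry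

/-!
The theorem follows from one statement, `exists_isStableMetric_coarselyLE`: every compatible
left-invariant metric `d` on `Aut(M)` satisfies `d ≲ d'` for some compatible left-invariant stable
metric `d'`. If `d` is maximal then so is `d'`, by transitivity of `≲`. If `d` is metrically proper
then so is `d'`: a `d'`-bounded set is `d`-bounded, hence has property (OB), and the converse holds
for any compatible left-invariant metric.

To construct `d'`, let `a` be a finite tuple of `M` whose stabiliser lies in the unit ball of `d`.
The orbit of `a` is countable, say with elements `f_0 a, f_1 a, …`. Join `g a` to `g f_i a` by an
edge whose weight is, up to a constant, the maximum of `i` and `d(1, f_i)`, and let `ρ` be the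
resulting integer-valued path metric on the orbit. Then `d(g, h) ≤ ρ(g a, h a) + 1`. The metric `d'`
is the sum of `ρ(g a, h a)` and of a bounded metric, `disagreement`, inducing the topology.

Stability of `d'` comes from definability. Each weight occurs on edges from only finitely many
`Aut(M)`-orbits of pairs. In a countable atomic model the orbits of finite tuples are definable, by
a back-and-forth argument (`exists_formula_realize_iff_mem_orbit`), so the relations `ρ ≤ n` are
definable, being obtained from such orbits by finite unions and compositions. In a stable theory
definable relations do not have the order property (`not_hasOrderProperty_of_stable`): an ultrapower
would otherwise realise the order pattern along a linear order with more than `κ` points which is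
separated by at most `κ` of them, giving more than `κ` types over a set of size at most `κ`. On
bounded sequences `d'` is a summable combination of indicator functions of relations `ρ ≤ n` and
of equalities `g x = h x`. For a symmetric relation without the order property the iterated
limits along an ultrafilter agree, and dominated convergence passes this on to `d'`
(`iterated_limits_eq`).
-/

namespace AutGeometry

/-! ### Stable theories and the order property -/

/-- A binary relation has the order property if it orders some pair of infinite sequences. -/
def HasOrderProperty {α : Type*} (R : α → α → Prop) : Prop :=
  ∃ x y : ℕ → α, ∀ i j, R (x i) (y j) ↔ i ≤ j

/-- For every infinite cardinal `κ` there is a linear order with more than `κ` elements and a subset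
of at most `κ` elements separating its points. -/
theorem exists_linearOrder_card_gt (κ : Cardinal.{u}) (hκ : Cardinal.aleph0 ≤ κ) :
    ∃ (I : Type u) (_ : LinearOrder I) (D : Set I), κ < Cardinal.mk I ∧ Cardinal.mk D ≤ κ ∧
      ∀ f g : I, f < g → ∃ h ∈ D, f ≤ h ∧ h < g := by
  classical
  -- With `μ` least such that `2 ^ μ > κ`, the lexicographic order on `μ → Bool` works.
  let S : Set Cardinal.{u} := {μ | κ < 2 ^ μ}
  have hS : S.Nonempty := ⟨κ, Cardinal.cantor κ⟩
  let μ := sInf S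
  have hμ : κ < 2 ^ μ := csInf_mem hS
  have hμκ : μ ≤ κ := csInf_le' (Cardinal.cantor κ)
  have hlt : ∀ ν < μ, (2 : Cardinal.{u}) ^ ν ≤ κ := fun ν hν => by
    by_contra h
    exact absurd (csInf_le' (s := S) (not_le.1 h)) (not_le.2 hν)
  let J := μ.ord.ToType
  -- The separating points: arbitrary below some `i`, `false` at `i`, and `true` above `i`.
  let e : (Σ i : J, (Set.Iio i → Bool)) → Lex (J → Bool) := fun p =>
    toLex fun j => if h : j < p.1 then p.2 ⟨j, h⟩ else decide (j ≠ p.1)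
  refine ⟨Lex (J → Bool), inferInstance, Set.range e, ?_, ?_, ?_⟩
  · have : Cardinal.mk (Lex (J → Bool)) = 2 ^ μ := by
      change Cardinal.mk (J → Bool) = _
      simp [J]
    rwa [this]
  · refine Cardinal.mk_range_le.trans ?_
    rw [Cardinal.mk_sigma]
    refine (Cardinal.sum_le_mk_mul_iSup _).trans ?_
    refine (mul_le_mul' (b := κ) (d := κ) ?_ ?_).trans_eq (Cardinal.mul_eq_self hκ)
    · simpa [J] using hμκ
    · refine ciSup_le' fun i => ?_
      have : Cardinal.mk (Set.Iio i) < μ := by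
        have := Cardinal.mk_Iio_lt i (by simp [J])
        simpa [J] using this
      simpa using hlt _ this
  · -- If `f < g` first differ at `i`, the separating point keeps the values of `f` below `i`.
    intro f g hfg
    obtain ⟨i, hi, hfi⟩ := hfg
    have hf : f i = false ∧ g i = true := by
      revert hfi
      change f i < g i → _
      cases f i <;> cases g i <;> simp
    refine ⟨e ⟨i, fun j => f j⟩, ⟨_, rfl⟩, ?_, ?_⟩
    · refine Pi.toLex_monotone (a := ofLex f) fun j => ?_
      change f j ≤ _
      by_cases hj : j < i
      · simp [hj]
      · by_cases hji : j = i
        · subst hji; simp [hf.1]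
        · simp [hj, hji]
    · refine ⟨i, fun j hj => ?_, ?_⟩
      · change (if h : j < i then _ else _) = _
        rw [dif_pos hj]
        exact hi j hj
      · change (if h : i < i then _ else _) < g i
        simp [hf.2]

/-- In an ultrapower of `M`, a formula ordering a pair of `ω`-sequences of `M` orders a pair of
`I`-sequences, for any linear order `I`. -/
theorem exists_model_orders {L : FirstOrder.Language.{u, v}} (T : L.Theory) {M : Type w}
    [L.Structure M] [Nonempty M] [M ⊨ T] {k : ℕ} (φ : L.Formula (Fin k ⊕ Fin k))
    (hφ : HasOrderProperty fun x y : Fin k → M => φ.Realize (Sum.elim x y))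
    (I : Type (max u v w)) [LinearOrder I] :
    ∃ (N : Type (max u v w)) (_ : L.Structure N) (_ : Nonempty N) (_ : N ⊨ T)
      (a b : I → Fin k → N), ∀ i j, φ.Realize (Sum.elim (a i) (b j)) ↔ i ≤ j := by
  classical
  obtain ⟨x, y, hxy⟩ := hφ
  let U : Ultrafilter (Finset I) := Ultrafilter.of atTop
  have hU : ∀ i : I, ∀ᶠ s in (U : Filter (Finset I)), i ∈ s := fun i =>
    Ultrafilter.of_le atTop (by
      filter_upwards [eventually_ge_atTop ({i} : Finset I)] with s hs
      exact hs (Finset.mem_singleton_self i))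
  -- the position of `i` in the finite set `s`
  let rk : Finset I → I → ℕ := fun s i => (s.filter (· < i)).card
  have hrk : ∀ (s : Finset I) (i j : I), j ∈ s → (rk s i ≤ rk s j ↔ i ≤ j) := by
    intro s i j hj
    constructor
    · intro h
      by_contra hij
      rw [not_le] at hij
      refine absurd h (not_le.2 (Finset.card_lt_card ?_))
      refine ⟨fun t ht => ?_, fun hs => ?_⟩
      · simp only [Finset.mem_filter] at ht ⊢
        exact ⟨ht.1, ht.2.trans hij⟩
      · simpa using hs (Finset.mem_filter.2 ⟨hj, hij⟩)
    · intro h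
      refine Finset.card_le_card fun t ht => ?_
      simp only [Finset.mem_filter] at ht ⊢
      exact ⟨ht.1, ht.2.trans_le h⟩
  refine ⟨(U : Filter (Finset I)).Product fun _ => M, inferInstance, inferInstance, ?_,
    fun i l => ((fun s => x (rk s i) l : ∀ _ : Finset I, M) : (U : Filter (Finset I)).Product _),
    fun i l => ((fun s => y (rk s i) l : ∀ _ : Finset I, M) : (U : Filter (Finset I)).Product _),
    fun i j => ?_⟩
  · refine ⟨fun ψ hψ => ?_⟩
    rw [FirstOrder.Language.Ultraproduct.sentence_realize]
    exact Eventually.of_forall fun _ => T.realize_sentence_of_mem hψ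
  · have key := FirstOrder.Language.Ultraproduct.realize_formula_cast (u := U) (M := fun _ => M) φ
      (Sum.elim (fun l s => x (rk s i) l) (fun l s => y (rk s j) l))
    have h1 : (fun t : Fin k ⊕ Fin k => ((Sum.elim (fun l s => x (rk s i) l)
        (fun l s => y (rk s j) l) t : ∀ _ : Finset I, M) :
          (U : Filter (Finset I)).Product fun _ => M)) =
        Sum.elim (fun l => ((fun s => x (rk s i) l : ∀ _ : Finset I, M) :
          (U : Filter (Finset I)).Product _)) (fun l => ((fun s => y (rk s j) l :
            ∀ _ : Finset I, M) : (U : Filter (Finset I)).Product _)) := by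
      ext t; cases t <;> rfl
    rw [h1] at key
    refine Iff.trans key ?_
    have h2 : ∀ s : Finset I, (fun t : Fin k ⊕ Fin k => Sum.elim (fun l s => x (rk s i) l)
        (fun l s => y (rk s j) l) t s) = Sum.elim (x (rk s i)) (y (rk s j)) := by
      intro s; ext t; cases t <;> rfl
    simp only [h2, hxy]
    rw [← eventually_const (f := (U : Filter (Finset I))) (p := i ≤ j)]
    refine eventually_congr ?_
    filter_upwards [hU j] with s hs using hrk s i j hs

/-- In a model of a stable theory no formula has the order property: otherwise, an ultrapower would
order a large linear order, whose points have different types over a small separating set. -/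
theorem not_hasOrderProperty_of_stable {L : FirstOrder.Language.{u, v}} {T : L.Theory}
    (hT : IsStableTheory.{u, v, w} T) {M : Type w} [L.Structure M] [Nonempty M] [M ⊨ T] {k : ℕ}
    (φ : L.Formula (Fin k ⊕ Fin k)) :
    ¬ HasOrderProperty fun x y : Fin k → M => φ.Realize (Sum.elim x y) := by
  intro hφ
  obtain ⟨κ, hκ, hst⟩ := hT
  obtain ⟨I, _, D, hI, hD, hsep⟩ := exists_linearOrder_card_gt κ hκ
  obtain ⟨N, _, _, _, a, b, hab⟩ := exists_model_orders T φ hφ I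
  let A : Set N := Set.range fun p : D × Fin k => b p.1 p.2
  have hA : Cardinal.mk A ≤ κ := by
    have := Cardinal.mk_range_le_lift (f := fun p : D × Fin k => b p.1 p.2)
    simp only [Cardinal.lift_id, Cardinal.lift_uzero, Cardinal.mk_prod, Cardinal.mk_fin,
      Cardinal.lift_natCast] at this
    refine this.trans ?_
    refine (mul_le_mul' hD (Cardinal.natCast_lt_aleph0.le.trans hκ)).trans_eq
      (Cardinal.mul_eq_self hκ)
  refine absurd (hst N A hA k) (not_le.2 (hI.trans_le ?_))
  let tp : I → TypesOver (L := L) N A k := fun i => (L[[A]].completeTheory N).typeOf (a i)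
  refine Cardinal.mk_le_of_injective (f := tp) ?_
  have main : ∀ f g : I, f < g → tp f ≠ tp g := by
    intro f g hfg h
    obtain ⟨t, htD, hft, htg⟩ := hsep f g hfg
    -- the formula `φ(x, b_t)`
    let c : Fin k → A := fun l => ⟨b t l, ⟨(⟨t, htD⟩, l), rfl⟩⟩
    let ψ : L[[A]].Formula (Fin k) := FirstOrder.Language.BoundedFormula.constantsVarsEquiv.symm
      (φ.relabel (Sum.elim Sum.inr (Sum.inl ∘ c)) : L.Formula (A ⊕ Fin k))
    have hψ : ∀ i, ψ.Realize (a i) ↔ i ≤ t := by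
      intro i
      rw [← hab i t]
      unfold FirstOrder.Language.Formula.Realize
      rw [← FirstOrder.Language.BoundedFormula.realize_constantsVarsEquiv, Equiv.apply_symm_apply]
      change FirstOrder.Language.Formula.Realize _ _ ↔ _
      rw [FirstOrder.Language.Formula.realize_relabel]
      unfold FirstOrder.Language.Formula.Realize
      have : (Sum.elim (fun a : A => ((L.con a : L[[A]].Constants) : N)) (a i) ∘
          Sum.elim Sum.inr (Sum.inl ∘ c)) = Sum.elim (a i) (b t) := by
        ext l; cases l <;> simp [c]
      rw [this]
    have h1 : ∀ i, FirstOrder.Language.Formula.equivSentence ψ ∈ tp i ↔ i ≤ t := fun i =>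
      FirstOrder.Language.Theory.CompleteType.formula_mem_typeOf.trans (hψ i)
    exact absurd ((h1 g).1 (h ▸ (h1 f).2 hft)) (not_le.2 htg)
  intro f g h
  rcases lt_trichotomy f g with hlt | heq | hlt
  · exact absurd h (main f g hlt)
  · exact heq
  · exact absurd h.symm (main g f hlt)

/-! ### Homogeneity of countable atomic models -/

section Homogeneity

variable {L : FirstOrder.Language.{u, v}} {M : Type w} [L.Structure M]

/-- A set of pairs is elementary if its projections satisfy the same formulas. -/
def IsElementaryCorrespondence (L : FirstOrder.Language.{u, v}) {M : Type w} [L.Structure M]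
    (S : Set (M × M)) : Prop :=
  ∀ (n : ℕ) (p : Fin n → M × M), (∀ i, p i ∈ S) → ∀ φ : L.Formula (Fin n),
    φ.Realize (fun i => (p i).1) ↔ φ.Realize (fun i => (p i).2)

theorem IsElementaryCorrespondence.swap {S : Set (M × M)}
    (hS : IsElementaryCorrespondence L S) :
    IsElementaryCorrespondence L (Prod.swap ⁻¹' S) := fun n p hp φ =>
  (hS n (fun i => (p i).swap) hp φ).symm

theorem isElementaryCorrespondence_range {n : ℕ} {p : Fin n → M × M}
    (h : ∀ φ : L.Formula (Fin n), φ.Realize (fun i => (p i).1) ↔ φ.Realize (fun i => (p i).2)) :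
    IsElementaryCorrespondence L (Set.range p) := by
  intro m q hq φ
  choose σ hσ using hq
  have := h (φ.relabel σ)
  simp only [FirstOrder.Language.Formula.realize_relabel] at this
  simpa [Function.comp_def, hσ] using this

theorem IsElementaryCorrespondence.fst_eq_iff_snd_eq {S : Set (M × M)}
    (hS : IsElementaryCorrespondence L S) {p q : M × M} (hp : p ∈ S) (hq : q ∈ S) :
    p.1 = q.1 ↔ p.2 = q.2 := by
  have := hS 2 ![p, q] (by simp [Fin.forall_fin_two, hp, hq])
    (FirstOrder.Language.Term.equal (FirstOrder.Language.Term.var 0)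
      (FirstOrder.Language.Term.var 1))
  simpa [FirstOrder.Language.Formula.realize_equal] using this

/-- The extension step of the back-and-forth: a formula isolating the type of the enlarged tuple
provides the new point. -/
theorem IsElementaryCorrespondence.exists_insert {T : L.Theory} [Nonempty M]
    (hM : IsAtomicModel T M) {S : Finset (M × M)}
    (hS : IsElementaryCorrespondence L (S : Set (M × M))) (c : M) :
    ∃ d : M, IsElementaryCorrespondence L (insert (c, d) (S : Set (M × M))) := by
  obtain ⟨hMT, hat⟩ := hM
  obtain ⟨n, p, hp⟩ : ∃ (n : ℕ) (p : Fin n → M × M), Set.range p = S := by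
    refine ⟨S.card, fun i => (S.equivFin.symm i : M × M), ?_⟩
    ext q
    simp only [Set.mem_range, Finset.mem_coe]
    exact ⟨fun ⟨i, hi⟩ => hi ▸ (S.equivFin.symm i).2,
      fun hq => ⟨S.equivFin ⟨q, hq⟩, by simp⟩⟩
  obtain ⟨φ, hφ, hiso⟩ := hat (n + 1) (Fin.snoc (fun i => (p i).1) c)
  have hext : ∀ a : Fin n → M, (FirstOrder.Language.Formula.iExs (Fin 1)
      (φ.relabel (Fin.snoc Sum.inl (Sum.inr 0) : Fin (n + 1) → Fin n ⊕ Fin 1))).Realize a ↔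
      ∃ d, φ.Realize (Fin.snoc a d : Fin (n + 1) → M) := by
    intro a
    rw [FirstOrder.Language.Formula.realize_iExs]
    simp only [FirstOrder.Language.Formula.realize_relabel]
    have : ∀ i : Fin 1 → M, Sum.elim a i ∘ (Fin.snoc Sum.inl (Sum.inr 0) :
        Fin (n + 1) → Fin n ⊕ Fin 1) = Fin.snoc a (i 0) := by
      intro i
      ext l
      refine Fin.lastCases ?_ (fun l => ?_) l <;> simp
    simp only [this]
    exact ⟨fun ⟨i, hi⟩ => ⟨i 0, hi⟩, fun ⟨d, hd⟩ => ⟨fun _ => d, hd⟩⟩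
  obtain ⟨d, hd⟩ := (hext _).1 ((hS n p (fun i => hp ▸ Set.mem_range_self i) _).1
    ((hext fun i => (p i).1).2 ⟨c, hφ⟩))
  refine ⟨d, ?_⟩
  have hr : insert (c, d) (S : Set (M × M)) =
      Set.range (Fin.snoc p (c, d) : Fin (n + 1) → M × M) := by
    rw [Fin.range_snoc, hp]
  rw [hr]
  have h1 : (fun i => ((Fin.snoc p (c, d) : Fin (n + 1) → M × M) i).1) =
      (Fin.snoc (fun i => (p i).1) c : Fin (n + 1) → M) := by
    ext l; refine Fin.lastCases ?_ (fun l => ?_) l <;> simp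
  have h2 : (fun i => ((Fin.snoc p (c, d) : Fin (n + 1) → M × M) i).2) =
      (Fin.snoc (fun i => (p i).2) d : Fin (n + 1) → M) := by
    ext l; refine Fin.lastCases ?_ (fun l => ?_) l <;> simp
  have himp : ∀ ψ : L.Formula (Fin (n + 1)),
      ψ.Realize (Fin.snoc (fun i => (p i).1) c : Fin (n + 1) → M) →
      ψ.Realize (Fin.snoc (fun i => (p i).2) d : Fin (n + 1) → M) := fun ψ hψ =>
    FirstOrder.Language.Formula.realize_imp.1
      ((hiso ψ hψ).realize_formula M) hd
  refine isElementaryCorrespondence_range fun ψ => ?_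
  rw [h1, h2]
  refine ⟨himp ψ, fun h => ?_⟩
  by_contra hn
  exact FirstOrder.Language.Formula.realize_not.1
    (himp ψ.not (FirstOrder.Language.Formula.realize_not.2 hn)) h

/-- A total and surjective elementary correspondence is the graph of an automorphism. -/
theorem IsElementaryCorrespondence.exists_aut {S : Set (M × M)}
    (hS : IsElementaryCorrespondence L S) (h1 : ∀ c, ∃ d, (c, d) ∈ S) (h2 : ∀ d, ∃ c, (c, d) ∈ S) :
    ∃ g : Aut L M, ∀ p ∈ S, g p.1 = p.2 := by
  choose f hf using h1
  choose f' hf' using h2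
  have key : ∀ p ∈ S, f p.1 = p.2 := fun p hp =>
    (IsElementaryCorrespondence.fst_eq_iff_snd_eq hS (hf p.1) hp).1 rfl
  refine ⟨⟨⟨f, f', fun c => ?_, fun d => key _ (hf' d)⟩, fun {n} F x => ?_, fun {n} R x => ?_⟩, key⟩
  · exact (IsElementaryCorrespondence.fst_eq_iff_snd_eq hS (hf' (f c)) (hf c)).2 rfl
  · have := hS (n + 1) (Fin.snoc (fun i => (x i, f (x i)))
      (FirstOrder.Language.Structure.funMap F x, f (FirstOrder.Language.Structure.funMap F x)))
      (fun i => by refine Fin.lastCases ?_ (fun l => ?_) i <;> simp [hf])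
      (FirstOrder.Language.Term.equal (FirstOrder.Language.Term.func F
        (fun i => FirstOrder.Language.Term.var (Fin.castSucc i)))
          (FirstOrder.Language.Term.var (Fin.last n)))
    simp only [FirstOrder.Language.Formula.realize_equal, FirstOrder.Language.Term.realize_func,
      FirstOrder.Language.Term.realize_var, Fin.snoc_castSucc, Fin.snoc_last, true_iff] at this
    exact this.symm
  · have := hS n (fun i => (x i, f (x i))) (fun i => hf _)
      (FirstOrder.Language.Relations.formula R (fun i => FirstOrder.Language.Term.var i))
    simp only [FirstOrder.Language.Formula.realize_rel,
      FirstOrder.Language.Term.realize_var] at this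
    exact this.symm

/-- A countable atomic model is homogeneous: a formula isolating the type of a finite tuple
defines its orbit under the automorphism group. -/
theorem exists_formula_realize_iff_mem_orbit {T : L.Theory} [Nonempty M] [Countable M]
    (hM : IsAtomicModel T M) {n : ℕ} (a : Fin n → M) :
    ∃ φ : L.Formula (Fin n), ∀ b, φ.Realize b ↔ ∃ g : Aut L M, ∀ i, g (a i) = b i := by
  classical
  obtain ⟨φ, hφ, hiso⟩ := hM.2 n a
  have := hM.1
  refine ⟨φ, fun b => ⟨fun hb => ?_, ?_⟩⟩
  · have himp : ∀ ψ : L.Formula (Fin n), ψ.Realize a → ψ.Realize b := fun ψ hψ =>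
      FirstOrder.Language.Formula.realize_imp.1 ((hiso ψ hψ).realize_formula M) hb
    obtain ⟨e, he⟩ := exists_surjective_nat M
    let P : Type w := {S : Finset (M × M) // IsElementaryCorrespondence L (S : Set (M × M))}
    have hstep : ∀ (S : P) (c : M), ∃ S' : P, S.1 ⊆ S'.1 ∧ (∃ d, (c, d) ∈ S'.1) ∧
        ∃ d, (d, c) ∈ S'.1 := by
      intro S c
      obtain ⟨d, hd⟩ := S.2.exists_insert hM c
      rw [← Finset.coe_insert] at hd
      have hsw : IsElementaryCorrespondence L
          (((insert (c, d) S.1).image Prod.swap : Finset (M × M)) : Set (M × M)) := by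
        rw [Finset.coe_image, Set.image_swap_eq_preimage_swap]
        exact hd.swap
      obtain ⟨d', hd'⟩ := hsw.exists_insert hM c
      have hfin := hd'.swap
      refine ⟨⟨insert (d', c) (insert (c, d) S.1), ?_⟩, fun p hp => by simp [hp],
        ⟨d, by simp⟩, ⟨d', by simp⟩⟩
      refine (iff_of_eq (congrArg _ ?_)).1 hfin
      ext ⟨p, q⟩
      simp only [Set.mem_preimage, Finset.coe_image, Set.mem_insert_iff, Finset.coe_insert,
        Set.image_swap_eq_preimage_swap, Prod.swap_prod_mk, Prod.mk.injEq]
      simp only [and_comm]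
    choose step hsub hdom hran using hstep
    let S₀ : P := ⟨Finset.univ.image fun i => (a i, b i), by
      rw [Finset.coe_image, Finset.coe_univ, Set.image_univ]
      refine isElementaryCorrespondence_range fun ψ => ⟨himp ψ, fun h => ?_⟩
      by_contra hn
      exact FirstOrder.Language.Formula.realize_not.1
        (himp ψ.not (FirstOrder.Language.Formula.realize_not.2 hn)) h⟩
    let F : ℕ → P := fun m => Nat.rec S₀ (fun m S => step S (e m)) m
    have hmono : Monotone fun m => (F m).1 := monotone_nat_of_le_succ fun m => hsub (F m) (e m)
    have hU : IsElementaryCorrespondence L {p | ∃ m, p ∈ (F m).1} := by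
      intro k p hp ψ
      choose m hm using hp
      exact (F (Finset.univ.sup m)).2 k p
        (fun i => hmono (Finset.le_sup (Finset.mem_univ i)) (hm i)) ψ
    obtain ⟨g, hg⟩ := hU.exists_aut
      (fun c => by
        obtain ⟨m, rfl⟩ := he c
        obtain ⟨d, hd⟩ := hdom (F m) (e m)
        exact ⟨d, m + 1, hd⟩)
      (fun c => by
        obtain ⟨m, rfl⟩ := he c
        obtain ⟨d, hd⟩ := hran (F m) (e m)
        exact ⟨d, m + 1, hd⟩)
    exact ⟨g, fun i => hg (a i, b i) ⟨0, Finset.mem_image_of_mem _ (Finset.mem_univ i)⟩⟩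
  · rintro ⟨g, hg⟩
    have : b = g ∘ a := funext fun i => (hg i).symm
    rw [this]
    exact (FirstOrder.Language.StrongHomClass.realize_formula g φ).2 hφ

end Homogeneity

/-! ### Interchanging iterated limits -/

section IteratedLimits

variable {X : Type*}

/-- If `R` holds along one iterated ultrafilter limit and fails along the other, points can be
picked alternately from the two sequences so as to witness the order property. -/
theorem eventually_eventually_of_not_hasOrderProperty {R : X → X → Prop}
    (hR : ¬ HasOrderProperty R) (U : Ultrafilter ℕ) (x y : ℕ → X)
    (h : ∀ᶠ i in U, ∀ᶠ j in U, R (x i) (y j)) : ∀ᶠ j in U, ∀ᶠ i in U, R (x i) (y j) := by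
  classical
  by_contra hn
  rw [← Ultrafilter.eventually_not] at hn
  simp only [← Ultrafilter.eventually_not] at hn
  obtain ⟨f, hf, hf'⟩ := exists_seq_of_forall_finset_exists
    (fun p : ℕ × ℕ => (∀ᶠ j in U, R (x p.1) (y j)) ∧ (∀ᶠ i in U, ¬ R (x i) (y p.2)) ∧
      R (x p.1) (y p.2))
    (fun p q => R (x p.1) (y q.2) ∧ ¬ R (x q.1) (y p.2)) (by
      intro s hs
      have h1 : ∀ᶠ i in U, ∀ p ∈ s, ¬ R (x i) (y p.2) :=
        (s.eventually_all).2 fun p hp => (hs p hp).2.1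
      obtain ⟨i, hi, hi'⟩ := (h.and h1).exists
      have h2 : ∀ᶠ j in U, ∀ p ∈ s, R (x p.1) (y j) :=
        (s.eventually_all).2 fun p hp => (hs p hp).1
      obtain ⟨j, ⟨hj, hj'⟩, hij⟩ := ((hn.and h2).and hi).exists
      exact ⟨(i, j), ⟨hi, hj, hij⟩, fun p hp => ⟨hj' p hp, hi' p hp⟩⟩)
  refine hR ⟨fun n => x (f n).1, fun n => y (f n).2, fun m n => ?_⟩
  rcases lt_trichotomy m n with hmn | rfl | hmn
  · simp [hmn.le, (hf' m n hmn).1]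
  · simp [(hf m).2.2]
  · simp [hmn, (hf' n m hmn).2]

theorem eventually_comm_of_not_hasOrderProperty {R : X → X → Prop}
    (hsymm : ∀ x y, R x y → R y x) (hR : ¬ HasOrderProperty R) (U : Ultrafilter ℕ) (x y : ℕ → X) :
    (∀ᶠ i in U, ∀ᶠ j in U, R (x i) (y j)) ↔ ∀ᶠ j in U, ∀ᶠ i in U, R (x i) (y j) := by
  have hiff : ∀ x y, R x y ↔ R y x := fun x y => ⟨hsymm x y, hsymm y x⟩
  refine ⟨eventually_eventually_of_not_hasOrderProperty hR U x y, fun h => ?_⟩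
  have := eventually_eventually_of_not_hasOrderProperty hR U y x
  simp only [hiff (y _)] at this
  exact this h

open Classical in
/-- Iterated limits of a function which is a summable combination of indicator functions of
symmetric relations without the order property may be interchanged. -/
theorem iterated_limits_eq {κ : Type*} {R : κ → X → X → Prop}
    (hsymm : ∀ n x y, R n x y → R n y x) (hR : ∀ n, ¬ HasOrderProperty (R n)) {c : κ → ℝ}
    (hc0 : ∀ n, 0 ≤ c n) (hc : Summable c) (x y : ℕ → X) {a b : ℕ → ℝ} {r s : ℝ}
    (ha : ∀ n, Tendsto (fun m => ∑' k, if R k (x n) (y m) then 0 else c k) atTop (𝓝 (a n)))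
    (hr : Tendsto a atTop (𝓝 r))
    (hb : ∀ m, Tendsto (fun n => ∑' k, if R k (x n) (y m) then 0 else c k) atTop (𝓝 (b m)))
    (hs : Tendsto b atTop (𝓝 s)) : r = s := by
  let U := hyperfilter ℕ
  have hU : (U : Filter ℕ) ≤ atTop := Nat.hyperfilter_le_atTop
  -- a sequence of propositions converges along an ultrafilter, to its eventual truth value
  have hlim : ∀ P : ℕ → κ → Prop, Tendsto (fun n => ∑' k, if P n k then 0 else c k) U
      (𝓝 (∑' k, if ∀ᶠ n in U, P n k then 0 else c k)) := by
    intro P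
    refine tendsto_tsum_of_dominated_convergence hc (fun k => ?_)
      (Eventually.of_forall fun n k => ?_)
    · refine tendsto_const_nhds.congr' ?_
      by_cases h : ∀ᶠ n in U, P n k
      · filter_upwards [h] with n hn
        simp [h, hn]
      · have h' := Ultrafilter.eventually_not.2 h
        filter_upwards [h'] with n hn
        simp [h, hn]
    · split_ifs
      · simpa using hc0 k
      · simp [abs_of_nonneg (hc0 k)]
  have ha' : a = fun n => ∑' k, if ∀ᶠ m in U, R k (x n) (y m) then 0 else c k := funext fun n =>
    tendsto_nhds_unique ((ha n).mono_left hU) (hlim fun m k => R k (x n) (y m))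
  have hb' : b = fun m => ∑' k, if ∀ᶠ n in U, R k (x n) (y m) then 0 else c k := funext fun m =>
    tendsto_nhds_unique ((hb m).mono_left hU) (hlim fun n k => R k (x n) (y m))
  subst ha' hb'
  rw [tendsto_nhds_unique (hr.mono_left hU) (hlim fun n k => ∀ᶠ m in U, R k (x n) (y m)),
    tendsto_nhds_unique (hs.mono_left hU) (hlim fun m k => ∀ᶠ n in U, R k (x n) (y m))]
  simp only [eventually_comm_of_not_hasOrderProperty (hsymm _) (hR _) U x y]

end IteratedLimits

/-! ### Weighted paths -/

section WeightedPath

variable {α : Type*}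

/-- `WeightedPath R n x y` says that `x` and `y` are joined by a path of total weight `n`, where
the steps in the relation `R j` have weight `j + 1`. -/
inductive WeightedPath (R : ℕ → α → α → Prop) : ℕ → α → α → Prop
  | refl (x : α) : WeightedPath R 0 x x
  | step {i j : ℕ} {x y z : α} (h : R j x y) (p : WeightedPath R i y z) :
      WeightedPath R (i + j + 1) x z

namespace WeightedPath

variable {R : ℕ → α → α → Prop}

theorem single {j : ℕ} {x y : α} (h : R j x y) : WeightedPath R (j + 1) x y := by
  simpa using step h (refl (R := R) y)

theorem trans {m n : ℕ} {x y z : α} (p : WeightedPath R m x y) (q : WeightedPath R n y z) :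
    WeightedPath R (m + n) x z := by
  induction p with
  | refl x => simpa using q
  | @step i j x y' z' h p ih =>
    have := step h (ih q)
    rwa [show i + n + j + 1 = i + j + 1 + n by ring] at this

theorem symm (hR : ∀ j x y, R j x y → R j y x) {n : ℕ} {x y : α} (p : WeightedPath R n x y) :
    WeightedPath R n y x := by
  induction p with
  | refl x => exact refl x
  | step h p ih => exact ih.trans (single (hR _ _ _ h))

theorem map (f : α → α) (hR : ∀ j x y, R j x y → R j (f x) (f y)) {n : ℕ} {x y : α}
    (p : WeightedPath R n x y) : WeightedPath R n (f x) (f y) := by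
  induction p with
  | refl x => exact refl _
  | step h p ih => exact step (hR _ _ _ h) ih

theorem iff_eq_or_exists_step {n : ℕ} {x y : α} : WeightedPath R n x y ↔
    (n = 0 ∧ x = y) ∨ ∃ i : Fin n, ∃ j : Fin n, (i : ℕ) + j + 1 = n ∧
      ∃ z, R j x z ∧ WeightedPath R i z y := by
  constructor
  · rintro (_ | @⟨i, j, _, z, _, h, p⟩)
    · exact Or.inl ⟨rfl, rfl⟩
    · exact Or.inr ⟨⟨i, by omega⟩, ⟨j, by omega⟩, rfl, z, h, p⟩
  · rintro (⟨rfl, rfl⟩ | ⟨i, j, hij, z, h, p⟩)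
    · exact refl _
    · rw [← hij]; exact step h p

end WeightedPath

end WeightedPath

/-! ### Definable relations between tuples -/

section Definable

open FirstOrder.Language

variable (L : FirstOrder.Language.{u, v}) {M : Type w} [L.Structure M] {k : ℕ}

/-- A relation between `k`-tuples of `M` is definable without parameters. -/
def IsDefinableRel (R : (Fin k → M) → (Fin k → M) → Prop) : Prop :=
  ∃ φ : L.Formula (Fin k ⊕ Fin k), ∀ x y, φ.Realize (Sum.elim x y) ↔ R x y

variable {L}

theorem IsDefinableRel.of_iff {R R' : (Fin k → M) → (Fin k → M) → Prop} (hR : IsDefinableRel L R)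
    (h : ∀ x y, R' x y ↔ R x y) : IsDefinableRel L R' :=
  hR.imp fun _ hφ x y => (hφ x y).trans (h x y).symm

theorem isDefinableRel_const (p : Prop) :
    IsDefinableRel L fun _ _ : Fin k → M => p := by
  by_cases hp : p
  · exact ⟨⊤, fun x y => by simp [hp]⟩
  · exact ⟨⊥, fun x y => by simp [hp]⟩

theorem isDefinableRel_eq : IsDefinableRel L fun x y : Fin k → M => x = y :=
  ⟨Formula.iInf fun i : Fin k => Term.equal (Term.var (Sum.inl i)) (Term.var (Sum.inr i)),
    fun x y => by simp [Formula.realize_equal, funext_iff]⟩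

theorem IsDefinableRel.and {R R' : (Fin k → M) → (Fin k → M) → Prop} (hR : IsDefinableRel L R)
    (hR' : IsDefinableRel L R') : IsDefinableRel L fun x y => R x y ∧ R' x y := by
  obtain ⟨φ, hφ⟩ := hR
  obtain ⟨ψ, hψ⟩ := hR'
  exact ⟨φ ⊓ ψ, fun x y => by rw [Formula.realize_inf, hφ, hψ]⟩

theorem IsDefinableRel.or {R R' : (Fin k → M) → (Fin k → M) → Prop} (hR : IsDefinableRel L R)
    (hR' : IsDefinableRel L R') : IsDefinableRel L fun x y => R x y ∨ R' x y := by
  obtain ⟨φ, hφ⟩ := hR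
  obtain ⟨ψ, hψ⟩ := hR'
  exact ⟨φ ⊔ ψ, fun x y => by rw [Formula.realize_sup, hφ, hψ]⟩

theorem IsDefinableRel.swap {R : (Fin k → M) → (Fin k → M) → Prop} (hR : IsDefinableRel L R) :
    IsDefinableRel L fun x y => R y x := by
  obtain ⟨φ, hφ⟩ := hR
  exact ⟨φ.relabel Sum.swap, fun x y => by
    rw [Formula.realize_relabel, show Sum.elim x y ∘ Sum.swap = Sum.elim y x from
      funext fun t => by cases t <;> rfl, hφ]⟩

theorem IsDefinableRel.exists_finite {ι : Type*} [Finite ι]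
    {R : ι → (Fin k → M) → (Fin k → M) → Prop} (hR : ∀ i, IsDefinableRel L (R i)) :
    IsDefinableRel L fun x y => ∃ i, R i x y := by
  choose φ hφ using hR
  exact ⟨Formula.iSup φ, fun x y => by simp [hφ]⟩

theorem IsDefinableRel.comp {R R' : (Fin k → M) → (Fin k → M) → Prop} (hR : IsDefinableRel L R)
    (hR' : IsDefinableRel L R') : IsDefinableRel L fun x y => ∃ z, R x z ∧ R' z y := by
  obtain ⟨φ, hφ⟩ := hR
  obtain ⟨ψ, hψ⟩ := hR'
  refine ⟨Formula.iExs (Fin k)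
    (φ.relabel (Sum.elim (Sum.inl ∘ Sum.inl) Sum.inr : _ → (Fin k ⊕ Fin k) ⊕ Fin k) ⊓
      ψ.relabel (Sum.elim Sum.inr (Sum.inl ∘ Sum.inr) : _ → (Fin k ⊕ Fin k) ⊕ Fin k)),
    fun x y => ?_⟩
  rw [Formula.realize_iExs]
  refine exists_congr fun z => ?_
  rw [Formula.realize_inf, Formula.realize_relabel, Formula.realize_relabel, ← hφ, ← hψ]
  have h1 : Sum.elim (Sum.elim x y) z ∘ (Sum.elim (Sum.inl ∘ Sum.inl) Sum.inr :
      Fin k ⊕ Fin k → (Fin k ⊕ Fin k) ⊕ Fin k) = Sum.elim x z := by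
    ext t; cases t <;> rfl
  have h2 : Sum.elim (Sum.elim x y) z ∘ (Sum.elim Sum.inr (Sum.inl ∘ Sum.inr) :
      Fin k ⊕ Fin k → (Fin k ⊕ Fin k) ⊕ Fin k) = Sum.elim z y := by
    ext t; cases t <;> rfl
  rw [h1, h2]

theorem IsDefinableRel.weightedPath {R : ℕ → (Fin k → M) → (Fin k → M) → Prop}
    (hR : ∀ j, IsDefinableRel L (R j)) (n : ℕ) : IsDefinableRel L (WeightedPath R n) := by
  induction n using Nat.strong_induction_on with
  | _ n ih =>
    refine IsDefinableRel.of_iff ?_ fun x y => WeightedPath.iff_eq_or_exists_step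
    exact ((isDefinableRel_const _).and isDefinableRel_eq).or
      (.exists_finite fun i => .exists_finite fun j =>
        (isDefinableRel_const _).and ((hR j).comp (ih i i.2)))

theorem IsDefinableRel.not_hasOrderProperty {T : L.Theory} (hT : IsStableTheory.{u, v, w} T)
    [Nonempty M] [M ⊨ T] {R : (Fin k → M) → (Fin k → M) → Prop} (hR : IsDefinableRel L R) :
    ¬ HasOrderProperty R := by
  obtain ⟨φ, hφ⟩ := hR
  have := not_hasOrderProperty_of_stable hT (M := M) φ
  simpa only [hφ] using this

/-- In a countable atomic model, the orbit of a pair of finite tuples under the diagonal action of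
the automorphism group is definable. -/
theorem isDefinableRel_orbit {T : L.Theory} [Nonempty M] [Countable M] (hM : IsAtomicModel T M)
    (a b : Fin k → M) : IsDefinableRel L fun x y => ∃ g : Aut L M, x = g ∘ a ∧ y = g ∘ b := by
  obtain ⟨φ, hφ⟩ := exists_formula_realize_iff_mem_orbit hM (Sum.elim a b ∘ finSumFinEquiv.symm)
  refine ⟨φ.relabel finSumFinEquiv.symm, fun x y => ?_⟩
  rw [Formula.realize_relabel, hφ]
  refine exists_congr fun g => ?_
  refine (finSumFinEquiv.symm.surjective.forall
    (p := fun i => g (Sum.elim a b i) = Sum.elim x y i)).symm.trans ?_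
  simp [Sum.forall, funext_iff, eq_comm]

end Definable

/-! ### Metrics on the automorphism group -/

section AutTopology

variable {L : FirstOrder.Language.{u, v}} {M : Type w} [L.Structure M]

theorem isOpen_setOf_eqOn (f : Aut L M) (A : Finset M) :
    IsOpen {g : Aut L M | ∀ x ∈ A, g x = f x} :=
  TopologicalSpace.GenerateOpen.basic _ ⟨f, A, rfl⟩

theorem exists_finset_of_isOpen {U : Set (Aut L M)} (hU : IsOpen U) {f : Aut L M} (hf : f ∈ U) :
    ∃ A : Finset M, ∀ g : Aut L M, (∀ x ∈ A, g x = f x) → g ∈ U := by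
  classical
  induction hU generalizing f with
  | basic s hs =>
    obtain ⟨f', A, rfl⟩ := hs
    exact ⟨A, fun g hg x hx => (hg x hx).trans (hf x hx)⟩
  | univ => exact ⟨∅, fun _ _ => trivial⟩
  | inter s t _ _ ihs iht =>
    obtain ⟨A, hA⟩ := ihs hf.1
    obtain ⟨B, hB⟩ := iht hf.2
    exact ⟨A ∪ B, fun g hg => ⟨hA g fun x hx => hg x (Finset.mem_union_left _ hx),
      hB g fun x hx => hg x (Finset.mem_union_right _ hx)⟩⟩
  | sUnion S _ ih =>
    obtain ⟨s, hs, hfs⟩ := hf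
    obtain ⟨A, hA⟩ := ih s hs hfs
    exact ⟨A, fun g hg => ⟨s, hs, hA g hg⟩⟩

open Classical in
/-- The distance between two automorphisms given by the points of an enumeration `e` on which they
disagree, the `n`-th point having weight `2⁻ⁿ`. -/
noncomputable def disagreement (e : ℕ → M) (g h : Aut L M) : ℝ :=
  ∑' n, if g (e n) = h (e n) then 0 else (1 / 2 : ℝ) ^ n

section Disagreement

variable (e : ℕ → M)

open Classical in
theorem summable_disagreement (g h : Aut L M) :
    Summable fun n => if g (e n) = h (e n) then 0 else (1 / 2 : ℝ) ^ n :=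
  summable_geometric_two.of_nonneg_of_le (fun n => by split_ifs <;> positivity)
    (fun n => by split_ifs <;> [positivity; exact le_rfl])

theorem disagreement_nonneg (g h : Aut L M) : 0 ≤ disagreement e g h :=
  tsum_nonneg fun n => by split_ifs <;> positivity

theorem disagreement_self (g : Aut L M) : disagreement e g g = 0 := by
  simp [disagreement]

theorem disagreement_comm (g h : Aut L M) : disagreement e g h = disagreement e h g := by
  classical
  exact tsum_congr fun _ => if_congr eq_comm rfl rfl

theorem disagreement_triangle (f g h : Aut L M) :
    disagreement e f h ≤ disagreement e f g + disagreement e g h := by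
  classical
  unfold disagreement
  rw [← (summable_disagreement e f g).tsum_add (summable_disagreement e g h)]
  refine (summable_disagreement e f h).tsum_le_tsum (fun n => ?_)
    ((summable_disagreement e f g).add (summable_disagreement e g h))
  have : (0 : ℝ) < (1 / 2) ^ n := by positivity
  by_cases h1 : f (e n) = g (e n)
  · simp [h1]
  · by_cases h2 : f (e n) = h (e n)
    · simp only [h2, if_true]
      split_ifs <;> linarith
    · simp only [h1, h2, if_false]
      split_ifs <;> linarith

theorem disagreement_mul_left (f g h : Aut L M) :
    disagreement e (f * g) (f * h) = disagreement e g h := by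
  classical
  refine tsum_congr fun n => ?_
  have : (f * g) (e n) = (f * h) (e n) ↔ g (e n) = h (e n) := f.injective.eq_iff
  exact if_congr this rfl rfl

theorem eq_of_disagreement_lt {g h : Aut L M} {n : ℕ}
    (hlt : disagreement e g h < (1 / 2 : ℝ) ^ n) : g (e n) = h (e n) := by
  classical
  by_contra hne
  refine absurd hlt (not_lt.2 ?_)
  have := (summable_disagreement e g h).le_tsum n (fun j _ => by split_ifs <;> positivity)
  rwa [if_neg hne] at this

theorem continuous_disagreement (g : Aut L M) : Continuous (disagreement e g) := by
  classical
  refine continuous_tsum (fun n => ?_) summable_geometric_two fun n h => ?_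
  · refine IsLocallyConstant.continuous (IsLocallyConstant.iff_exists_open _ |>.2 fun h => ?_)
    exact ⟨_, isOpen_setOf_eqOn h {e n}, fun _ _ => rfl, fun h' hh' => by
      rw [hh' (e n) (Finset.mem_singleton_self _)]⟩
  · split_ifs
    · simp
    · simp

end Disagreement

/-- Adding `disagreement` to a left-invariant pseudometric vanishing on pairs of automorphisms that
agree on a fixed finite set produces a compatible left-invariant metric. -/
theorem exists_isCompatibleLeftInvariant_dist_eq_add {e : ℕ → M} (he : Function.Surjective e)
    {ρ : Aut L M → Aut L M → ℝ} (h0 : ∀ g h, 0 ≤ ρ g h) (hcomm : ∀ g h, ρ g h = ρ h g)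
    (htri : ∀ f g h, ρ f h ≤ ρ f g + ρ g h) (hleft : ∀ f g h, ρ (f * g) (f * h) = ρ g h)
    (A : Finset M) (hA : ∀ g h : Aut L M, (∀ x ∈ A, g x = h x) → ρ g h = 0) :
    ∃ d : MetricSpace (Aut L M), IsCompatibleLeftInvariant d ∧
      ∀ g h, d.dist g h = ρ g h + disagreement e g h := by
  refine ⟨MetricSpace.ofDistTopology (fun g h => ρ g h + disagreement e g h)
    (fun g => ?_) (fun g h => ?_) (fun f g h => ?_) (fun s => ⟨fun hs g hg => ?_, fun hs => ?_⟩)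
    (fun g h hgh => ?_), ⟨rfl, fun f g h => ?_⟩, fun g h => rfl⟩
  · rw [hA g g fun _ _ => rfl, disagreement_self, add_zero]
  · rw [hcomm, disagreement_comm]
  · linarith [htri f g h, disagreement_triangle e f g h]
  · obtain ⟨B, hB⟩ := exists_finset_of_isOpen hs hg
    choose p hp using he
    refine ⟨(1 / 2 : ℝ) ^ B.sup p, by positivity, fun h hh => hB h fun x hx => ?_⟩
    have hle : (1 / 2 : ℝ) ^ B.sup p ≤ (1 / 2) ^ p x :=
      pow_le_pow_of_le_one (by norm_num) (by norm_num) (Finset.le_sup hx)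
    have := eq_of_disagreement_lt e (g := g) (h := h) (n := p x) (by linarith [h0 g h])
    rw [hp] at this
    exact this.symm
  · rw [isOpen_iff_mem_nhds]
    intro g hg
    obtain ⟨ε, hε, hball⟩ := hs g hg
    have h1 : ∀ᶠ h in 𝓝 g, disagreement e g h < ε := by
      refine (continuous_disagreement e g).continuousAt.eventually_lt continuousAt_const ?_
      rwa [disagreement_self]
    filter_upwards [h1, (isOpen_setOf_eqOn g A).mem_nhds fun _ _ => rfl] with h hh hh'
    refine hball h ?_
    rw [hA g h fun x hx => (hh' x hx).symm]
    linarith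
  · have hD : disagreement e g h = 0 := by
      linarith [h0 g h, disagreement_nonneg e g h]
    refine FirstOrder.Language.Equiv.ext fun x => ?_
    obtain ⟨n, rfl⟩ := he x
    exact eq_of_disagreement_lt e (by rw [hD]; positivity)
  · change ρ _ _ + disagreement e _ _ = ρ _ _ + disagreement e _ _
    rw [hleft, disagreement_mul_left]

end AutTopology

theorem not_hasOrderProperty_apply_eq {X Y : Type*} (f : X → Y) :
    ¬ HasOrderProperty fun x y => f x = f y := by
  rintro ⟨x, y, h⟩
  have : f (x 1) = f (y 0) := (((h 1 1).2 le_rfl).trans ((h 0 1).2 zero_le_one).symm).trans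
    ((h 0 0).2 le_rfl)
  simpa using (h 1 0).1 this

/-- A metric that is the sum of an integer-valued function, whose sublevel sets do not have the
order property, and of `disagreement` is stable. -/
theorem isStableMetric_of_dist_eq {L : FirstOrder.Language.{u, v}} {M : Type w} [L.Structure M]
    {d : MetricSpace (Aut L M)} {e : ℕ → M} {N : Aut L M → Aut L M → ℕ}
    (hN : ∀ n, ¬ HasOrderProperty fun g h => N g h ≤ n) (hcomm : ∀ g h, N g h = N h g)
    (hd : ∀ g h, d.dist g h = N g h + disagreement e g h) : IsStableMetric d := by
  classical
  rintro x y ⟨C, hC⟩ ⟨C', hC'⟩ a b r s ha hr hb hs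
  -- On bounded sequences `N` is at most some `B`, so it is the number of `n < B` with `¬ N ≤ n`.
  obtain ⟨B, hB⟩ := exists_nat_ge (C + d.dist (x 0) (y 0) + C')
  have hNB : ∀ n m, N (x n) (y m) ≤ B := by
    intro n m
    have h1 := d.dist_triangle (x n) (x 0) (y m)
    have h2 := d.dist_triangle (x 0) (y 0) (y m)
    have h3 := hC _ ⟨n, rfl⟩ _ ⟨0, rfl⟩
    have h4 := hC' _ ⟨0, rfl⟩ _ ⟨m, rfl⟩
    have h5 := hd (x n) (y m)
    have h6 := disagreement_nonneg e (x n) (y m)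
    have : (N (x n) (y m) : ℝ) ≤ B := by linarith
    exact_mod_cast this
  let R : ℕ ⊕ ℕ → Aut L M → Aut L M → Prop :=
    Sum.elim (fun n g h => N g h ≤ n) fun n g h => g (e n) = h (e n)
  let c : ℕ ⊕ ℕ → ℝ := Sum.elim (fun n => if n < B then 1 else 0) fun n => (1 / 2) ^ n
  have hc1 : Summable fun n : ℕ => if n < B then (1 : ℝ) else 0 :=
    summable_of_ne_finset_zero (s := Finset.range B) fun n hn => by simpa using hn
  have hdist : ∀ n m, d.dist (x n) (y m) = ∑' k, if R k (x n) (y m) then 0 else c k := by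
    intro n m
    have hl : ((fun k => if R k (x n) (y m) then 0 else c k) ∘ Sum.inl) =
        fun k : ℕ => if k < N (x n) (y m) then (1 : ℝ) else 0 := by
      funext k
      by_cases h : k < N (x n) (y m)
      · simp [R, c, h, h.trans_le (hNB n m)]
      · simp [R, c, h, not_lt.1 h]
    have hz : ∀ k ∉ Finset.range (N (x n) (y m)),
        (if k < N (x n) (y m) then (1 : ℝ) else 0) = 0 := fun k hk => by simpa using hk
    rw [hd, Summable.tsum_sum]
    · congr 1
      change _ = ∑' k : ℕ, ((fun k => if R k (x n) (y m) then 0 else c k) ∘ Sum.inl) k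
      rw [hl, tsum_eq_sum hz, Finset.sum_congr rfl fun k hk => if_pos (Finset.mem_range.1 hk)]
      simp
    · rw [hl]
      exact summable_of_ne_finset_zero hz
    · exact summable_disagreement e (x n) (y m)
  simp only [hdist] at ha hb
  refine iterated_limits_eq (R := R) (c := c) ?_ ?_ ?_ ?_ x y ha hr hb hs
  · rintro (n | n) g h hgh
    · exact (hcomm h g).trans_le hgh
    · exact hgh.symm
  · rintro (n | n)
    · exact hN n
    · exact not_hasOrderProperty_apply_eq fun g : Aut L M => g (e n)
  · rintro (n | n)
    · change (0 : ℝ) ≤ if n < B then 1 else 0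
      split_ifs <;> norm_num
    · exact pow_nonneg (by norm_num) n
  · exact Summable.sum _ hc1 summable_geometric_two

/-! ### Stable metrics dominating a given metric -/

/-- Every compatible left-invariant metric on the automorphism group of a countable atomic model of
a stable theory is coarsely dominated by a stable one. -/
theorem exists_isStableMetric_coarselyLE {L : FirstOrder.Language.{u, v}} {T : L.Theory}
    (hT : IsStableTheory.{u, v, w} T) {M : Type w} [L.Structure M] [Nonempty M] [Countable M]
    (hM : IsAtomicModel T M) {d : MetricSpace (Aut L M)} (hd : IsCompatibleLeftInvariant d) :
    ∃ d' : MetricSpace (Aut L M),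
      IsCompatibleLeftInvariant d' ∧ IsStableMetric d' ∧ CoarselyLE d d' := by
  classical
  have := hM.1
  obtain ⟨e, he⟩ := exists_surjective_nat M
  have hopen : IsOpen {g : Aut L M | d.dist g 1 < 1} := by
    rw [← hd.compatible]
    exact @Metric.isOpen_ball _ d.toPseudoMetricSpace 1 1
  obtain ⟨A, hA⟩ := exists_finset_of_isOpen hopen (f := 1)
    (show d.dist 1 1 < 1 by rw [d.dist_self]; exact one_pos)
  let a : Fin A.card → M := fun i => A.equivFin.symm i
  have ha : ∀ g h : Aut L M, g ∘ a = h ∘ a ↔ ∀ x ∈ A, g x = h x := fun g h =>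
    ⟨fun hgh x hx => by simpa [a] using congrFun hgh (A.equivFin ⟨x, hx⟩),
      fun hgh => funext fun i => hgh _ (A.equivFin.symm i).2⟩
  have hle_one : ∀ g h : Aut L M, g ∘ a = h ∘ a → d.dist g h ≤ 1 := by
    intro g h hgh
    have : d.dist (h⁻¹ * g) 1 < 1 := hA _ fun x hx =>
      (congrArg h.symm ((ha g h).1 hgh x hx)).trans (h.symm_apply_apply x)
    rw [← hd.left_invariant h, mul_inv_cancel_left, mul_one] at this
    exact this.le
  -- representatives of the cosets of the pointwise stabiliser of `A`
  obtain ⟨f, hf⟩ : ∃ f : ℕ → Aut L M, ∀ g : Aut L M, ∃ n, f n ∘ a = g ∘ a := by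
    have : Nonempty (Set.range fun g : Aut L M => (g ∘ a : Fin A.card → M)) :=
      ⟨⟨_, 1, rfl⟩⟩
    obtain ⟨o, ho⟩ := exists_surjective_nat (Set.range fun g : Aut L M => (g ∘ a : Fin A.card → M))
    choose f hf using fun n => (o n).2
    refine ⟨f, fun g => ?_⟩
    obtain ⟨n, hn⟩ := ho ⟨_, g, rfl⟩
    exact ⟨n, (hf n).trans (congrArg Subtype.val hn)⟩
  -- The pairs `(g a, g f_i a)` and their converses, for the finitely many `i ≤ j` such that
  -- `f_i` moves the identity by at most `j`.
  let R : ℕ → (Fin A.card → M) → (Fin A.card → M) → Prop := fun j x y =>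
    ∃ i : Fin (j + 1), d.dist 1 (f i) ≤ j ∧
      ((∃ g : Aut L M, x = g ∘ a ∧ y = g ∘ (f i ∘ a)) ∨
        ∃ g : Aut L M, y = g ∘ a ∧ x = g ∘ (f i ∘ a))
  have hRdef : ∀ j, IsDefinableRel L (R j) := fun j => .exists_finite fun i =>
    (isDefinableRel_const _).and
      ((isDefinableRel_orbit hM _ _).or (isDefinableRel_orbit hM _ _).swap)
  have hRsymm : ∀ j x y, R j x y → R j y x := fun j x y ⟨i, hi, h⟩ => ⟨i, hi, h.symm⟩
  have hRmap : ∀ (k : Aut L M) j x y, R j x y → R j (k ∘ x) (k ∘ y) := by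
    rintro k j x y ⟨i, hi, ⟨g, rfl, rfl⟩ | ⟨g, rfl, rfl⟩⟩
    · exact ⟨i, hi, Or.inl ⟨k * g, rfl, rfl⟩⟩
    · exact ⟨i, hi, Or.inr ⟨k * g, rfl, rfl⟩⟩
  have hRdist : ∀ j (g : Aut L M) y, R j (g ∘ a) y →
      ∃ h : Aut L M, y = h ∘ a ∧ d.dist g h ≤ j + 1 := by
    rintro j g y ⟨i, hi, ⟨k, hgk, rfl⟩ | ⟨k, rfl, hgk⟩⟩
    · refine ⟨k * f i, rfl, ?_⟩
      have h1 := d.dist_triangle g k (k * f i)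
      have h2 := hd.left_invariant k 1 (f i)
      rw [mul_one] at h2
      linarith [hle_one g k hgk]
    · refine ⟨k, rfl, ?_⟩
      have h1 := d.dist_triangle g (k * f i) k
      have h2 := hd.left_invariant k 1 (f i)
      rw [mul_one, d.dist_comm] at h2
      linarith [hle_one g (k * f i) hgk]
  have hpath : ∀ n x y, WeightedPath R n x y → ∀ g h : Aut L M, x = g ∘ a → y = h ∘ a →
      d.dist g h ≤ n + 1 := by
    intro n x y p
    induction p with
    | refl x =>
      intro g h hg hh
      simpa using hle_one g h (hg.symm.trans hh)
    | @step i j x y z hR p ih =>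
      rintro g h rfl hh
      obtain ⟨k, hk, hgk⟩ := hRdist j g _ hR
      have h1 := d.dist_triangle g k h
      have h2 := ih k h hk hh
      push_cast
      linarith
  have hjoin : ∀ g h : Aut L M, ∃ n, WeightedPath R n (g ∘ a) (h ∘ a) := by
    intro g h
    obtain ⟨i, hi⟩ := hf (g⁻¹ * h)
    obtain ⟨m, hm⟩ := exists_nat_ge (d.dist 1 (f i))
    refine ⟨max i m + 1, .single ⟨⟨i, by omega⟩, hm.trans ?_, Or.inl ⟨g, rfl, ?_⟩⟩⟩
    · exact_mod_cast le_max_right i m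
    · simp only [hi]
      exact funext fun l => (g.apply_symm_apply (h (a l))).symm
  let N : Aut L M → Aut L M → ℕ := fun g h => Nat.find (hjoin g h)
  have hN : ∀ g h : Aut L M, WeightedPath R (N g h) (g ∘ a) (h ∘ a) := fun g h =>
    Nat.find_spec (hjoin g h)
  have hNle : ∀ {g h : Aut L M} {n}, WeightedPath R n (g ∘ a) (h ∘ a) → N g h ≤ n := fun p =>
    Nat.find_min' _ p
  have hNcomm : ∀ g h, N g h = N h g := fun g h =>
    le_antisymm (hNle ((hN h g).symm hRsymm)) (hNle ((hN g h).symm hRsymm))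
  have hNleft_le : ∀ k g h : Aut L M, N (k * g) (k * h) ≤ N g h := fun k g h =>
    hNle ((hN g h).map (k ∘ ·) (hRmap k))
  have hNleft : ∀ k g h : Aut L M, N (k * g) (k * h) = N g h := fun k g h =>
    le_antisymm (hNleft_le k g h) (by simpa using hNleft_le k⁻¹ (k * g) (k * h))
  obtain ⟨d', hd', hdist⟩ := exists_isCompatibleLeftInvariant_dist_eq_add he
    (ρ := fun g h : Aut L M => (N g h : ℝ)) (fun g h => Nat.cast_nonneg _)
    (fun g h => congrArg Nat.cast (hNcomm g h))
    (fun f g h => by exact_mod_cast hNle ((hN f g).trans (hN g h)))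
    (fun f g h => congrArg Nat.cast (hNleft f g h)) A (fun g h hgh => by
      have : N g h ≤ 0 := hNle (by rw [(ha g h).2 hgh]; exact .refl _)
      exact_mod_cast Nat.le_zero.1 this)
  refine ⟨d', hd', isStableMetric_of_dist_eq (fun n => ?_) hNcomm hdist, 1, fun g h => ?_⟩
  · have hdef : IsDefinableRel L fun x y => ∃ m : Fin (n + 1), WeightedPath R m x y :=
      .exists_finite fun m => .weightedPath hRdef m
    rintro ⟨x, y, hxy⟩
    refine hdef.not_hasOrderProperty hT ⟨fun i => x i ∘ a, fun i => y i ∘ a, fun i j => ?_⟩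
    rw [← hxy i j]
    exact ⟨fun ⟨m, hm⟩ => (hNle hm).trans (Nat.lt_succ_iff.1 m.2),
      fun h => ⟨⟨N (x i) (y j), Nat.lt_succ_iff.2 h⟩, hN _ _⟩⟩
  · have h1 := hpath _ _ _ (hN g h) g h rfl rfl
    have h2 := disagreement_nonneg e g h
    rw [hdist]
    linarith

theorem CoarselyLE.trans {X : Type w} {d₁ d₂ d₃ : MetricSpace X} (h : CoarselyLE d₁ d₂)
    (h' : CoarselyLE d₂ d₃) : CoarselyLE d₁ d₃ := by
  obtain ⟨K, hK⟩ := h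
  obtain ⟨K', hK'⟩ := h'
  refine ⟨|K| * |K'| + |K|, fun x y => ?_⟩
  have h0 : 0 ≤ d₃.dist x y := @dist_nonneg _ d₃.toPseudoMetricSpace x y
  have h0' : 0 ≤ d₂.dist x y := @dist_nonneg _ d₂.toPseudoMetricSpace x y
  have h1 : d₁.dist x y ≤ |K| * d₂.dist x y + |K| :=
    (hK x y).trans (add_le_add (mul_le_mul_of_nonneg_right (le_abs_self K) h0') (le_abs_self K))
  have h2 : d₂.dist x y ≤ |K'| * d₃.dist x y + |K'| :=
    (hK' x y).trans (add_le_add (mul_le_mul_of_nonneg_right (le_abs_self K') h0) (le_abs_self K'))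
  have h3 := mul_le_mul_of_nonneg_left h2 (abs_nonneg K)
  have h4 := mul_nonneg (abs_nonneg K) h0
  nlinarith

theorem IsBoundedFor.of_coarselyLE {X : Type w} {d d' : MetricSpace X} (h : CoarselyLE d d')
    {A : Set X} (hA : IsBoundedFor d' A) : IsBoundedFor d A := by
  obtain ⟨K, hK⟩ := h
  obtain ⟨C, hC⟩ := hA
  refine ⟨|K| * C + |K|, fun x hx y hy => (hK x y).trans ?_⟩
  have h0 : 0 ≤ d'.dist x y := @dist_nonneg _ d'.toPseudoMetricSpace x y
  exact add_le_add ((mul_le_mul_of_nonneg_right (le_abs_self K) h0).trans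
    (mul_le_mul_of_nonneg_left (hC x hx y hy) (abs_nonneg K))) (le_abs_self K)

end AutGeometry

theorem mainTheorem7 {L : FirstOrder.Language.{u, v}} [Countable L.Symbols]
    (T : L.Theory) (hT : T.IsComplete) (hstable : IsStableTheory.{u, v, w} T)
    (M : Type w) [L.Structure M] [Nonempty M] [Countable M] (hM : IsAtomicModel T M) :
    ((∃ d : MetricSpace (Aut L M), IsMaximalMetric d) →
      ∃ d : MetricSpace (Aut L M), IsMaximalMetric d ∧ IsStableMetric d) ∧
    ((∃ d : MetricSpace (Aut L M), IsCompatibleLeftInvariant d ∧ IsMetricallyProper d) →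
      ∃ d : MetricSpace (Aut L M),
        IsCompatibleLeftInvariant d ∧ IsMetricallyProper d ∧ IsStableMetric d) := by
  constructor
  · rintro ⟨d, hd, hmax⟩
    obtain ⟨d', hd', hst, hle⟩ := exists_isStableMetric_coarselyLE hstable hM hd
    exact ⟨d', ⟨hd', fun e he hde => (hmax e he (hle.trans hde)).trans hle⟩, hst⟩
  · rintro ⟨d, hd, hprop⟩
    obtain ⟨d', hd', hst, hle⟩ := exists_isStableMetric_coarselyLE hstable hM hd
    exact ⟨d', hd', fun A => ⟨fun hA => (hprop A).1 (hA.of_coarselyLE hle), fun hA => hA d' hd'⟩,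
      hst⟩
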